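/- Let $\mathbb{F}$ be a (commutative) field, let $E_6(\mathbb{F})$ be the building of type $E_6$ over $\mathbb{F}$, with Bourbaki labelling of the nodes (node $1$ is an end node whose only neighbour is node $3$), and let $\Gamma = E_{6,1}(\mathbb{F})$ be its $1$-shadow geometry: the points of $\Gamma$ are the elements of type $1$ of the building, and the lines of $\Gamma$ are the sets formed by all points incident with a given element of type $3$. Concretely, let $V$ be the minuscule module over $\mathbb{F}$ of the simply connected Chevalley group $G$ of type $E_6$ over $\mathbb{F}$ with highest weight the first fundamental weight, so that $V$ has a basis of weight vectors indexed by the weights in the Weyl group orbit of that weight; the elements of type $k$ of $E_6(\mathbb{F})$ are the left cosets $gP_k$ in $G$ of the standard maximal parabolic subgroup $P_k$, and two elements are incident when the corresponding cosets intersect. Let $\varepsilon:\Gamma\to V$ be the standard projective embedding, which maps the point $gP_1$ to the $1$-dimensional subspace $g\langle v_0\rangle$ of $V$, where $v_0$ is a highest weight vector, and maps a line $L$ to the span $\langle \varepsilon(p)\rangle_{p\in L}$. Let $\mathrm{Aut}(\Gamma)$ be the group of all permutations $\alpha$ of the point set of $\Gamma$ such that a set $L$ of points is a line if and only if $\alpha(L)$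 is a line. Let $\widehat{G}^\circ$ be the lifting of $\mathrm{Aut}(\Gamma)$ to $V$ through $\varepsilon$, namely the group of all automorphisms $\varphi$ of the additive group of $V$ for which there exists $\alpha\in\mathrm{Aut}(\Gamma)$ such that $\varphi(\varepsilon(X)) = \varepsilon(\alpha(X))$ for every point and every line $X$ of $\Gamma$. Then $V$ has dimension $27$ over $\mathbb{F}$, and the $\widehat{G}^\circ$-module $V$ is irreducible: $V\neq 0$, and the only subgroups of the additive group of $V$ (in particular, the only vector subspaces of $V$) that are stabilized by $\widehat{G}^\circ$ are $0$ and $V$. -/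

import Mathlib

namespace ExcE6

/-! ### The 27 weights of the minuscule module

Weights are written in the basis of fundamental weights, so `μ i` is the pairing of `μ` with the
`i`-th simple coroot, and the `i`-th simple root is the `i`-th row of the Cartan matrix. The nodes
`1, …, 6` of the Bourbaki labelling are the indices `0, …, 5`. -/

/-- The orbit of the first fundamental weight under the Weyl group of type `E₆`. -/
inductive IsWeight : (Fin 6 → ℤ) → Prop
  | highest : IsWeight (Pi.single 0 1)
  | reflect (i : Fin 6) (μ : Fin 6 → ℤ) :
      IsWeight μ → IsWeight (fun j => μ j - μ i * CartanMatrix.E₆ i j)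

/-- The type of weights of the minuscule module with highest weight the first fundamental weight. -/
abbrev Weight : Type := {μ : Fin 6 → ℤ // IsWeight μ}

/-- The highest weight. -/
def highestWeight : Weight := ⟨Pi.single 0 1, IsWeight.highest⟩

/-- The `i`-th simple reflection, acting on weights: `μ ↦ μ - μ i • αᵢ`. -/
def refl (i : Fin 6) (μ : Weight) : Weight :=
  ⟨fun j => μ.1 j - μ.1 i * CartanMatrix.E₆ i j, IsWeight.reflect i μ.1 μ.2⟩

/-- The space `V` with one basis vector for each weight. -/
abbrev V (F : Type*) : Type _ := Weight → F

theorem refl_apply_self (i : Fin 6) (μ : Weight) : (refl i μ).1 i = - μ.1 i := by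
  have h : CartanMatrix.E₆ i i = 2 := by fin_cases i <;> rfl
  simp only [refl, h]; ring

theorem refl_refl (i : Fin 6) (μ : Weight) : refl i (refl i μ) = μ := by
  apply Subtype.ext
  funext j
  have h := refl_apply_self i μ
  change (refl i μ).1 j - (refl i μ).1 i * CartanMatrix.E₆ i j = μ.1 j
  rw [h]
  change (μ.1 j - μ.1 i * CartanMatrix.E₆ i j) - _ = _
  ring

section Group

variable (F : Type*) [Field F]

/-- The action of a Chevalley generator: for `s = 1` the generator `eᵢ` of the simple root `αᵢ`,
for `s = -1` the generator `fᵢ` of `-αᵢ`. In terms of the weight basis `(v_μ)`, the map sends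
`v_μ` to `v_{μ + s αᵢ}` if `μ i = -s` (that is, if `μ + s αᵢ` is again a weight) and to `0`
otherwise. -/
def chev (s : ℤ) (i : Fin 6) : V F →ₗ[F] V F where
  toFun v := fun μ => if μ.1 i = s then v (refl i μ) else 0
  map_add' v w := by
    funext μ; by_cases h : μ.1 i = s <;> simp [h]
  map_smul' c v := by
    funext μ; by_cases h : μ.1 i = s <;> simp [h]

theorem chev_chev {s : ℤ} (hs : s ≠ 0) (i : Fin 6) (v : V F) : chev F s i (chev F s i v) = 0 := by
  funext μ
  simp only [chev, LinearMap.coe_mk, AddHom.coe_mk, Pi.zero_apply]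
  split_ifs with h1 h2
  · rw [refl_apply_self, h1] at h2; omega
  · rfl
  · rfl

/-- The root element `1 + t e`, with `e` the Chevalley generator `eᵢ` (`s = 1`) or `fᵢ`
(`s = -1`). -/
def rootElt (s : ℤ) (hs : s ≠ 0) (i : Fin 6) (t : F) : V F ≃ₗ[F] V F :=
  LinearEquiv.ofLinearMap
    (LinearMap.id + t • chev F s i) (LinearMap.id - t • chev F s i)
    (by ext1 v; simp [chev_chev F hs])
    (by ext1 v; simp [chev_chev F hs])

/-- The root element `xᵢ(t) = 1 + t eᵢ` of the simple root `αᵢ`. -/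
def xElt (i : Fin 6) (t : F) : V F ≃ₗ[F] V F := rootElt F 1 one_ne_zero i t

/-- The root element `yᵢ(t) = 1 + t fᵢ` of the negative simple root `-αᵢ`. -/
def yElt (i : Fin 6) (t : F) : V F ≃ₗ[F] V F := rootElt F (-1) (neg_ne_zero.mpr one_ne_zero) i t

/-- The torus element `hᵢ(t)`, acting on the vectors of weight `μ` as the scalar `t ^ μ i`. -/
def torElt (i : Fin 6) (t : Fˣ) : V F ≃ₗ[F] V F :=
  LinearEquiv.piCongrRight fun μ => LinearEquiv.smulOfUnit (t ^ μ.1 i)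

/-- The Chevalley group of type `E₆` over `F`, in its action on the 27-dimensional module. -/
def G : Subgroup (V F ≃ₗ[F] V F) :=
  Subgroup.closure
    ({g | ∃ i t, g = torElt F i t} ∪ {g | ∃ i t, g = xElt F i t} ∪ {g | ∃ i t, g = yElt F i t})

/-- The maximal standard parabolic subgroup of `G` of type `k`: it is generated by the Borel
subgroup (which is generated by the torus and the positive simple root subgroups) and by the
negative simple root subgroups of all nodes other than `k`. -/
def P (k : Fin 6) : Subgroup (V F ≃ₗ[F] V F) :=
  Subgroup.closure
    ({g | ∃ i t, g = torElt F i t} ∪ {g | ∃ i t, g = xElt F i t} ∪ {g | ∃ i t, i ≠ k ∧ g = yElt F i t})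

/-! ### The building `E₆(F)` and its shadow geometry `E_{6,1}(F)` -/

/-- The elements of type `k` of the building `E₆(F)`: the left cosets in `G` of the maximal
standard parabolic subgroup of type `k`. -/
abbrev Elt (k : Fin 6) : Type _ := G F ⧸ (P F k).subgroupOf (G F)

variable {F}

/-- Two elements of the building are incident if, as cosets, they have an element in common. -/
def Incident {k l : Fin 6} (a : Elt F k) (b : Elt F l) : Prop :=
  ∃ g : G F, (QuotientGroup.mk g : Elt F k) = a ∧ (QuotientGroup.mk g : Elt F l) = b

variable (F)

/-- The points of `E_{6,1}(F)` are the elements of type 1 of the building (index `0`). -/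
abbrev Point : Type _ := Elt F 0

/-- The lines of `E_{6,1}(F)`, as sets of points: the 1-shadows of the elements of type 3
(index `2`), the node 3 being the only neighbour of the node 1 in the diagram. -/
def lines : Set (Set (Point F)) :=
  {L | ∃ b : Elt F 2, L = {p : Point F | Incident p b}}

/-- The automorphism group of the point-line geometry `E_{6,1}(F)`. -/
def autGeom : Subgroup (Equiv.Perm (Point F)) where
  carrier := {α | ∀ L : Set (Point F), α '' L ∈ lines F ↔ L ∈ lines F}
  mul_mem' := by
    intro α β hα hβ L
    rw [Equiv.Perm.coe_mul, Set.image_comp]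
    exact (hα _).trans (hβ L)
  one_mem' := by intro L; simp
  inv_mem' := by
    intro α hα L
    rw [← hα (⇑(α⁻¹ : Equiv.Perm (Point F)) '' L), ← Set.image_comp, ← Equiv.Perm.coe_mul]
    simp

/-! ### The 27-dimensional projective embedding -/

/-- The highest weight vector. -/
def highestVec : V F := by
  classical exact Pi.single highestWeight 1

theorem chev_highestVec {s : ℤ} {i : Fin 6} (hi : highestWeight.1 i ≠ -s) :
    chev F s i (highestVec F) = 0 := by
  classical
  funext μ
  simp only [chev, LinearMap.coe_mk, AddHom.coe_mk, Pi.zero_apply]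
  split_ifs with h1
  · have hne : refl i μ ≠ highestWeight := by
      intro he
      apply hi
      rw [← he, refl_apply_self, h1]
    simp only [highestVec]
    convert Pi.single_eq_of_ne (M := fun _ : Weight => F) hne (1 : F)
  · rfl

theorem map_highestVec_of_mem_P (g : V F ≃ₗ[F] V F) (hg : g ∈ P F 0) :
    (Submodule.span F {highestVec F}).map (g : V F →ₗ[F] V F) = Submodule.span F {highestVec F} := by
  classical
  have key : ∀ g : V F ≃ₗ[F] V F, (∃ c : Fˣ, g (highestVec F) = c • highestVec F) →
      (Submodule.span F {highestVec F}).map (g : V F →ₗ[F] V F) =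
        Submodule.span F {highestVec F} := by
    rintro g ⟨c, hc⟩
    rw [Submodule.map_span, Set.image_singleton]
    change Submodule.span F {g (highestVec F)} = _
    rw [hc]
    exact Submodule.span_singleton_group_smul_eq F c (highestVec F)
  apply key
  induction hg using Subgroup.closure_induction with
  | mem g hg =>
    rcases hg with (⟨i, t, rfl⟩ | ⟨i, t, rfl⟩) | ⟨i, t, hi, rfl⟩
    · refine ⟨t ^ highestWeight.1 i, ?_⟩
      funext μ
      change (t ^ μ.1 i) • highestVec F μ = (t ^ highestWeight.1 i) • highestVec F μ
      by_cases hμ : μ = highestWeight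
      · rw [hμ]
      · have h0 : highestVec F μ = 0 := by
          simp only [highestVec]
          convert Pi.single_eq_of_ne (M := fun _ : Weight => F) hμ (1 : F)
        rw [h0, smul_zero, smul_zero]
    · refine ⟨1, ?_⟩
      change highestVec F + t • chev F 1 i (highestVec F) = _
      rw [chev_highestVec F (by fin_cases i <;> decide)]
      simp
    · refine ⟨1, ?_⟩
      change highestVec F + t • chev F (-1) i (highestVec F) = _
      rw [chev_highestVec F (by fin_cases i <;> first | exact absurd rfl hi | decide)]
      simp
  | one => exact ⟨1, by simp⟩
  | mul a b _ _ ha hb =>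
    obtain ⟨c, hc⟩ := ha
    obtain ⟨d, hd⟩ := hb
    refine ⟨d * c, ?_⟩
    rw [LinearEquiv.mul_apply, hd, Units.smul_def, map_smul, hc, mul_smul, Units.smul_def, Units.smul_def]
  | inv a _ ha =>
    obtain ⟨c, hc⟩ := ha
    refine ⟨c⁻¹, ?_⟩
    apply a.injective
    rw [← LinearEquiv.mul_apply, mul_inv_cancel, LinearEquiv.coe_one, id, Units.smul_def, map_smul,
      hc, ← Units.smul_def, inv_smul_smul]

/-- The embedding on points: the coset of `g` goes to the image under `g` of the line spanned by
the highest weight vector. -/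
def embPoint : Point F → Submodule F (V F) :=
  Quotient.lift
    (fun g : G F => (Submodule.span F {highestVec F}).map ((g : V F ≃ₗ[F] V F) : V F →ₗ[F] V F))
    (by
      intro a b hab
      have hab' := QuotientGroup.leftRel_apply.mp hab
      rw [Subgroup.mem_subgroupOf] at hab'
      have hm := map_highestVec_of_mem_P F _ hab'
      have hb : (b : V F ≃ₗ[F] V F) = (a : V F ≃ₗ[F] V F) * ((a⁻¹ * b : G F) : V F ≃ₗ[F] V F) := by
        simp
      change _ = (Submodule.span F {highestVec F}).map ((b : V F ≃ₗ[F] V F) : V F →ₗ[F] V F)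
      rw [hb]
      change _ = (Submodule.span F {highestVec F}).map
        (((a : V F ≃ₗ[F] V F) : V F →ₗ[F] V F) ∘ₗ
          (((a⁻¹ * b : G F) : V F ≃ₗ[F] V F) : V F →ₗ[F] V F))
      rw [Submodule.map_comp, hm])

/-- The embedding on lines: a line goes to the span of the images of its points. -/
def embLine (L : Set (Point F)) : Submodule F (V F) := ⨆ p ∈ L, embPoint F p

/-- `φ` is a lifting of `α` through the embedding: an automorphism of the additive group of `V`
(that is, a `ℤ`-linear one) that maps the image of each point and line onto the image of its `α`-transform. -/
def Lifts (φ : V F ≃ₗ[ℤ] V F) (α : Equiv.Perm (Point F)) : Prop :=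
  (∀ p, φ '' (embPoint F p : Set (V F)) = embPoint F (α p)) ∧
    ∀ L ∈ lines F, φ '' (embLine F L : Set (V F)) = embLine F (α '' L)

/-- The lifting to `V` of the automorphism group of `E_{6,1}(F)`: the group of all liftings of its
elements. -/
def liftedAut : Subgroup (V F ≃ₗ[ℤ] V F) where
  carrier := {φ | ∃ α ∈ autGeom F, Lifts F φ α}
  mul_mem' := by
    rintro φ ψ ⟨α, hα, h1, h2⟩ ⟨β, hβ, h3, h4⟩
    have hc : ⇑(φ * ψ) = φ ∘ ψ := rfl
    refine ⟨α * β, mul_mem hα hβ, fun p => ?_, fun L hL => ?_⟩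
    · rw [hc, Set.image_comp, h3, h1]; rfl
    · rw [hc, Set.image_comp, h4 L hL, h2 _ ((hβ L).mpr hL), Equiv.Perm.coe_mul,
        Set.image_comp]
  one_mem' := ⟨1, one_mem _, fun p => by simp, fun L _ => by simp⟩
  inv_mem' := by
    rintro φ ⟨α, hα, h1, h2⟩
    have hinv : ∀ S T : Set (V F), φ '' S = T → (φ⁻¹ : V F ≃ₗ[ℤ] V F) '' T = S := by
      rintro S _ rfl
      have hc : ⇑(φ⁻¹ : V F ≃ₗ[ℤ] V F) ∘ φ = id := funext fun v => φ.symm_apply_apply v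
      rw [← Set.image_comp, hc, Set.image_id]
    refine ⟨α⁻¹, inv_mem hα, fun p => ?_, fun L hL => ?_⟩
    · apply hinv
      rw [h1]; simp
    · apply hinv
      rw [h2 _ ((inv_mem hα L).mpr hL), ← Set.image_comp, ← Equiv.Perm.coe_mul]
      simp

end Group

/-- The additive group `M`, regarded as a module for a group `A` of automorphisms of it (`ℤ`-linear
automorphisms, that is, all automorphisms of the additive group), is
irreducible: it is nonzero, and `0` and `M` are the only subgroups stabilized by `A`. (If `A`
contains all nonzero scalar maps of a vector space `M`, these are the only vector subspaces
stabilized by `A`.) -/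
def IsIrreducible {M : Type*} [AddCommGroup M] (A : Subgroup (M ≃ₗ[ℤ] M)) : Prop :=
  Nontrivial M ∧
    ∀ U : AddSubgroup M, (∀ φ ∈ A, ∀ u ∈ U, φ u ∈ U) → U = ⊥ ∨ U = ⊤

end ExcE6

namespace ExcE6

/-! The weights form a single Weyl orbit of size 27, and the module is minuscule: every coordinate
of a weight is `-1`, `0` or `1`. The lifted group contains the Chevalley group and all nonzero
scalars. Hence a stable subgroup `U` is closed under `F`-scaling and, by `IsStable.chev_mem`, under
each `eᵢ` and `fᵢ`. The products `eᵢfᵢ` and `fᵢeᵢ` are the projections onto the weights with `i`-th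
coordinate `1` and `-1`, so `U` contains every weight component of its elements
(`IsStable.single_apply_mem`). The torus is not used for this, so small fields, even of two
elements, need no separate treatment. A nonzero weight component is then carried by `eᵢ` and `fᵢ`
along the whole orbit, so `U` is everything if it is nonzero. -/

/-- The 27 weights of the minuscule module; each of them but the first, the highest weight, is a
simple reflection of an earlier one. -/
def weightTable : Fin 27 → Fin 6 → ℤ :=
  ![![1, 0, 0, 0, 0, 0], ![-1, 0, 1, 0, 0, 0], ![0, 0, -1, 1, 0, 0],
    ![0, 1, 0, -1, 1, 0], ![0, -1, 0, 0, 1, 0], ![0, 1, 0, 0, -1, 1],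
    ![0, -1, 0, 1, -1, 1], ![0, 1, 0, 0, 0, -1], ![0, 0, 1, -1, 0, 1],
    ![0, -1, 0, 1, 0, -1], ![1, 0, -1, 0, 0, 1], ![0, 0, 1, -1, 1, -1],
    ![-1, 0, 0, 0, 0, 1], ![1, 0, -1, 0, 1, -1], ![0, 0, 1, 0, -1, 0],
    ![-1, 0, 0, 0, 1, -1], ![1, 0, -1, 1, -1, 0], ![-1, 0, 0, 1, -1, 0],
    ![1, 1, 0, -1, 0, 0], ![-1, 1, 1, -1, 0, 0], ![1, -1, 0, 0, 0, 0],
    ![-1, -1, 1, 0, 0, 0], ![0, 1, -1, 0, 0, 0], ![0, -1, -1, 1, 0, 0],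
    ![0, 0, 0, -1, 1, 0], ![0, 0, 0, 0, -1, 1], ![0, 0, 0, 0, 0, -1]]

theorem weightTable_injective : Function.Injective weightTable := by
  decide +kernel

theorem weightTable_apply (k : Fin 27) (i : Fin 6) :
    weightTable k i = -1 ∨ weightTable k i = 0 ∨ weightTable k i = 1 := by
  revert k i
  decide +kernel

/-- Closure under simple reflections: the orbit has no weights outside the table. -/
theorem exists_weightTable_eq_reflect (k : Fin 27) (i : Fin 6) :
    ∃ l, weightTable l = fun j => weightTable k j - weightTable k i * CartanMatrix.E₆ i j := by
  revert k i
  decide +kernel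

theorem exists_lt_weightTable_eq_reflect (k : Fin 27) (hk : k ≠ 0) :
    ∃ l < k, ∃ i, weightTable k =
      fun j => weightTable l j - weightTable l i * CartanMatrix.E₆ i j := by
  revert k
  decide +kernel

theorem weightTable_zero : weightTable 0 = Pi.single 0 1 := by
  decide +kernel

theorem isWeight_weightTable (k : Fin 27) : IsWeight (weightTable k) := by
  induction k using WellFoundedLT.induction with
  | ind k ih =>
    by_cases hk : k = 0
    · rw [hk, weightTable_zero]
      exact IsWeight.highest
    · obtain ⟨l, hl, i, h⟩ := exists_lt_weightTable_eq_reflect k hk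
      rw [h]
      exact IsWeight.reflect i _ (ih l hl)

theorem IsWeight.exists_weightTable_eq {μ : Fin 6 → ℤ} (h : IsWeight μ) :
    ∃ k, weightTable k = μ := by
  induction h with
  | highest => exact ⟨0, weightTable_zero⟩
  | reflect i μ _ ih =>
    obtain ⟨k, rfl⟩ := ih
    exact exists_weightTable_eq_reflect k i

/-- The weights of the minuscule module are the entries of `weightTable`. -/
noncomputable def weightEquiv : Fin 27 ≃ Weight :=
  Equiv.ofBijective (fun k => ⟨weightTable k, isWeight_weightTable k⟩)
    ⟨fun _ _ h => weightTable_injective (congrArg Subtype.val h), fun μ => by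
      obtain ⟨k, hk⟩ := μ.2.exists_weightTable_eq
      exact ⟨k, Subtype.ext hk⟩⟩

noncomputable instance : Fintype Weight := Fintype.ofEquiv _ weightEquiv

theorem card_weight : Fintype.card Weight = 27 := by
  rw [← Fintype.card_congr weightEquiv, Fintype.card_fin]

theorem Weight.apply_eq (μ : Weight) (i : Fin 6) : μ.1 i = -1 ∨ μ.1 i = 0 ∨ μ.1 i = 1 := by
  obtain ⟨k, hk⟩ := μ.2.exists_weightTable_eq
  rw [← hk]
  exact weightTable_apply k i

theorem refl_eq_self {i : Fin 6} {μ : Weight} (h : μ.1 i = 0) : refl i μ = μ := by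
  apply Subtype.ext
  funext j
  simp [refl, h]

/-- A property of weights which holds for one of them and is preserved by the simple reflections
holds for all of them. -/
theorem Weight.forall_of_refl {p : Weight → Prop} (hp : ∀ i μ, p μ → p (refl i μ)) {μ : Weight}
    (hμ : p μ) (ν : Weight) : p ν := by
  -- Induction on the orbit starts only at the highest weight, whereas `μ` is arbitrary. The
  -- equivalence lets `p` travel both ways, simple reflections being involutions.
  have key : ∀ ν : Weight, p ν ↔ p highestWeight := by
    rintro ⟨ν, hν⟩
    induction hν with
    | highest => exact Iff.rfl
    | reflect i ν hν ih =>
      rw [← ih]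
      refine ⟨fun h => ?_, hp i ⟨ν, hν⟩⟩
      have := hp i _ h
      rwa [show (⟨_, IsWeight.reflect i ν hν⟩ : Weight) = refl i ⟨ν, hν⟩ from rfl,
        refl_refl] at this
  rw [key ν, ← key μ]
  exact hμ

/-! ### Chevalley generators on weight vectors -/

variable (F : Type*) [Field F]

theorem chev_apply (s : ℤ) (i : Fin 6) (v : V F) (μ : Weight) :
    chev F s i v μ = if μ.1 i = s then v (refl i μ) else 0 := rfl

theorem chev_neg_chev_apply (s : ℤ) (i : Fin 6) (v : V F) (μ : Weight) :
    chev F s i (chev F (-s) i v) μ = if μ.1 i = s then v μ else 0 := by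
  rw [chev_apply, chev_apply, refl_apply_self, refl_refl]
  by_cases h : μ.1 i = s <;> simp [h]

theorem chev_single [DecidableEq Weight] {s : ℤ} {i : Fin 6} {μ : Weight} (h : μ.1 i = -s)
    (c : F) : chev F s i (Pi.single μ c) = Pi.single (refl i μ) c := by
  funext ν
  rw [chev_apply]
  by_cases hν : ν = refl i μ
  · subst hν
    rw [refl_apply_self, refl_refl, h]
    simp
  · have hne : refl i ν ≠ μ := fun e => hν (by rw [← e, refl_refl])
    simp [hν, hne]

/-! ### The Chevalley group and the scalars inside the lifted automorphism group -/

variable {F}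

theorem embPoint_smul (g : G F) (p : Point F) :
    embPoint F (g • p) = (embPoint F p).map ((g : V F ≃ₗ[F] V F) : V F →ₗ[F] V F) := by
  obtain ⟨a, rfl⟩ := QuotientGroup.mk_surjective p
  exact Submodule.map_comp _ _ _

theorem incident_smul {k l : Fin 6} (g : G F) {a : Elt F k} {b : Elt F l} (h : Incident a b) :
    Incident (g • a) (g • b) := by
  obtain ⟨x, rfl, rfl⟩ := h
  exact ⟨g * x, rfl, rfl⟩

theorem image_smul_mem_lines (g : G F) {L : Set (Point F)} (hL : L ∈ lines F) :
    MulAction.toPerm g '' L ∈ lines F := by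
  obtain ⟨b, rfl⟩ := hL
  refine ⟨g • b, Set.ext fun p => ⟨?_, fun hp => ⟨g⁻¹ • p, ?_, smul_inv_smul g p⟩⟩⟩
  · rintro ⟨q, hq, rfl⟩
    exact incident_smul g hq
  · have := incident_smul g⁻¹ hp
    rwa [inv_smul_smul] at this

/-- Left translation preserves intersection of cosets, hence incidence; the converse follows by
translating with `g⁻¹`. -/
theorem toPerm_mem_autGeom (g : G F) : MulAction.toPerm g ∈ autGeom F := by
  refine fun L => ⟨fun h => ?_, image_smul_mem_lines g⟩
  have := image_smul_mem_lines g⁻¹ h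
  rw [← Set.image_comp] at this
  simpa [Function.comp_def] using this

/-- A linear map which acts on the images of the points through an automorphism of the geometry
belongs to the lifted automorphism group. -/
theorem restrictScalars_mem_liftedAut {φ : V F ≃ₗ[F] V F} {α : Equiv.Perm (Point F)}
    (hα : α ∈ autGeom F) (h : ∀ p, (embPoint F p).map (φ : V F →ₗ[F] V F) = embPoint F (α p)) :
    φ.restrictScalars ℤ ∈ liftedAut F := by
  refine ⟨α, hα, fun p => congrArg SetLike.coe (h p), fun L _ => ?_⟩
  -- A line is sent to the join of its points, and linear images commute with joins.
  have : (embLine F L).map (φ : V F →ₗ[F] V F) = embLine F (α '' L) := by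
    simp only [embLine, Submodule.map_iSup, h, iSup_image]
  exact congrArg SetLike.coe this

theorem restrictScalars_mem_liftedAut_of_mem_G {g : V F ≃ₗ[F] V F} (hg : g ∈ G F) :
    g.restrictScalars ℤ ∈ liftedAut F :=
  restrictScalars_mem_liftedAut (toPerm_mem_autGeom ⟨g, hg⟩)
    fun p => (embPoint_smul ⟨g, hg⟩ p).symm

/-- Scalars lift the identity of the geometry; they need not lie in `G F`. -/
theorem smulOfUnit_mem_liftedAut (c : Fˣ) :
    (LinearEquiv.smulOfUnit c : V F ≃ₗ[F] V F).restrictScalars ℤ ∈ liftedAut F := by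
  refine restrictScalars_mem_liftedAut (one_mem _) fun p => ?_
  apply le_antisymm
  · rintro _ ⟨v, hv, rfl⟩
    exact Submodule.smul_mem _ (c : F) hv
  · intro v hv
    exact ⟨(c⁻¹ : Fˣ) • v, Submodule.smul_mem _ ((c⁻¹ : Fˣ) : F) hv, smul_inv_smul c v⟩

/-! ### Irreducibility -/

/-- An additive subgroup of `V` which is stabilized by the lifted automorphism group. -/
def IsStable (U : AddSubgroup (V F)) : Prop := ∀ φ ∈ liftedAut F, ∀ u ∈ U, φ u ∈ U

namespace IsStable

variable {U : AddSubgroup (V F)}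

theorem smul_mem (hU : IsStable U) (c : F) {u : V F} (hu : u ∈ U) : c • u ∈ U := by
  by_cases hc : c = 0
  · rw [hc, zero_smul]
    exact U.zero_mem
  · exact hU _ (smulOfUnit_mem_liftedAut (Units.mk0 c hc)) u hu

/-- The root element with parameter `1` is `1 + chev F s i`, so subtracting `u` from its value at
`u` isolates the generator. -/
theorem chev_mem (hU : IsStable U) {s : ℤ} (hs : s = 1 ∨ s = -1) (i : Fin 6) {u : V F}
    (hu : u ∈ U) : chev F s i u ∈ U := by
  have h : ∃ g ∈ G F, g u = u + (1 : F) • chev F s i u := by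
    rcases hs with rfl | rfl
    · exact ⟨xElt F i 1, Subgroup.subset_closure (Or.inl (Or.inr ⟨i, 1, rfl⟩)), rfl⟩
    · exact ⟨yElt F i 1, Subgroup.subset_closure (Or.inr ⟨i, 1, rfl⟩), rfl⟩
  obtain ⟨g, hg, hgu⟩ := h
  have : g u ∈ U := hU _ (restrictScalars_mem_liftedAut_of_mem_G hg) u hu
  rw [hgu, one_smul] at this
  exact (AddSubgroup.add_mem_cancel_left U hu).mp this

theorem ite_mem_of_ne_zero (hU : IsStable U) {s : ℤ} (hs : s = 1 ∨ s = -1) (i : Fin 6) {u : V F}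
    (hu : u ∈ U) : (fun μ => if μ.1 i = s then u μ else 0) ∈ U := by
  have : chev F s i (chev F (-s) i u) ∈ U :=
    hU.chev_mem hs i (hU.chev_mem (by omega) i hu)
  rwa [show chev F s i (chev F (-s) i u) = fun μ => if μ.1 i = s then u μ else 0 from
    funext (chev_neg_chev_apply F s i u)] at this

/-- A stable subgroup is closed under the projections given by the values of one coordinate of the
weights. -/
theorem ite_mem (hU : IsStable U) (ν : Weight) (i : Fin 6) {u : V F} (hu : u ∈ U) :
    (fun μ => if μ.1 i = ν.1 i then u μ else 0) ∈ U := by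
  rcases ν.apply_eq i with h | h | h
  · rw [h]
    exact hU.ite_mem_of_ne_zero (Or.inr rfl) i hu
  -- Coordinates take only the values `-1`, `0`, `1`, so removing the parts at `1` and `-1` leaves
  -- the part at `0`.
  · have h1 := U.sub_mem (U.sub_mem hu (hU.ite_mem_of_ne_zero (Or.inl rfl) i hu))
      (hU.ite_mem_of_ne_zero (Or.inr rfl) i hu)
    convert h1 using 1
    funext μ
    rcases μ.apply_eq i with h' | h' | h' <;> simp [h, h']
  · rw [h]
    exact hU.ite_mem_of_ne_zero (Or.inl rfl) i hu

theorem ite_forall_mem (hU : IsStable U) (ν : Weight) (S : Finset (Fin 6)) {u : V F}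
    (hu : u ∈ U) : (fun μ : Weight => if ∀ i ∈ S, μ.1 i = ν.1 i then u μ else 0) ∈ U := by
  induction S using Finset.induction_on with
  | empty => simpa using hu
  | insert i S _ ih =>
    convert hU.ite_mem ν i ih using 1
    funext μ
    simp [ite_and]

/-- A weight is determined by its six coordinates, so the coordinate projections together isolate
one weight space. -/
theorem single_apply_mem [DecidableEq Weight] (hU : IsStable U) (ν : Weight) {u : V F}
    (hu : u ∈ U) : Pi.single ν (u ν) ∈ U := by
  convert hU.ite_forall_mem ν Finset.univ hu using 1
  funext μ
  have : (∀ i ∈ Finset.univ, μ.1 i = ν.1 i) ↔ μ = ν := by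
    simp [Subtype.ext_iff, funext_iff]
  by_cases h : μ = ν
  · subst h
    simp
  · simp only [this, h, if_false, Pi.single_eq_of_ne h]

/-- The reflection is realised by `eᵢ` at coordinate `-1`, by `fᵢ` at `1`, and is trivial at `0`. -/
theorem single_refl_mem [DecidableEq Weight] (hU : IsStable U) (i : Fin 6) (μ : Weight) (c : F)
    (h : Pi.single μ c ∈ U) : Pi.single (refl i μ) c ∈ U := by
  rcases μ.apply_eq i with hi | hi | hi
  · rw [← chev_single F (s := 1) hi]
    exact hU.chev_mem (Or.inl rfl) i h
  · rwa [refl_eq_self hi]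
  · rw [← chev_single F (s := -1) (by rw [hi, neg_neg])]
    exact hU.chev_mem (Or.inr rfl) i h

theorem eq_bot_or_eq_top (hU : IsStable U) : U = ⊥ ∨ U = ⊤ := by
  classical
  refine or_iff_not_imp_left.mpr fun hne => ?_
  obtain ⟨⟨u, hu⟩, hu0⟩ := AddSubgroup.ne_bot_iff_exists_ne_zero.mp hne
  replace hu0 : u ≠ 0 := fun h => hu0 (Subtype.ext h)
  obtain ⟨μ, hμ⟩ := Function.ne_iff.mp hu0
  have hsingle : ∀ (c : F) (ν : Weight), Pi.single ν c ∈ U := fun c ν => by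
    refine Weight.forall_of_refl (p := fun ν => Pi.single ν c ∈ U)
      (fun i ν h => hU.single_refl_mem i ν c h) (μ := μ) ?_ ν
    -- This factor turns the coefficient `u μ` into the prescribed `c`.
    have := hU.smul_mem (c * (u μ)⁻¹) (hU.single_apply_mem μ hu)
    rwa [← Pi.single_smul, smul_eq_mul, inv_mul_cancel_right₀ hμ] at this
  refine (AddSubgroup.eq_top_iff' U).mpr fun v => ?_
  rw [← Finset.univ_sum_single v]
  exact U.sum_mem fun ν _ => hsingle (v ν) ν

end IsStable

end ExcE6

theorem mainTheorem8 (F : Type*) [Field F] :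
    Module.finrank F (ExcE6.V F) = 27 ∧ ExcE6.IsIrreducible (ExcE6.liftedAut F) := by
  refine ⟨?_, ?_, fun U hU => ExcE6.IsStable.eq_bot_or_eq_top hU⟩
  · rw [Module.finrank_fintype_fun_eq_card, ExcE6.card_weight]
  · have : Nonempty ExcE6.Weight := ⟨ExcE6.highestWeight⟩
    exact Function.nontrivial
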